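/- Let $\mathbb{D}$ be the open unit disk and let $L^2=L^2(\partial\mathbb{D})$ be taken with respect to normalized arc length. Let $H^2\subset L^2$ be the Hardy space, identified through boundary values with the closed subspace of those functions in $L^2$ whose Fourier coefficients with negative indices vanish. An inner function is a bounded analytic function $\alpha$ on $\mathbb{D}$ with $|\alpha|=1$ a.e. on $\partial\mathbb{D}$ (in the sense of radial boundary values). For an inner function $\alpha$ let $K_\alpha=H^2\ominus\alpha H^2$ be the model space, $P_\alpha$ the orthogonal projection of $L^2$ onto $K_\alpha$, and $K_\alpha^\infty=K_\alpha\cap L^\infty(\partial\mathbb{D})$, which is a dense subspace of $K_\alpha$. For inner functions $\alpha,\beta$ and $\varphi\in L^2$, the asymmetric truncated Toeplitz operator with symbol $\varphi$ is the densely defined operator from $K_\alpha$ to $K_\beta$ given by $$A^{\alpha,\beta}_\varphi f=P_\beta(\varphi f),\qquad f\in K_\alpha^\infty;$$ when it is bounded, $A^{\alpha,\beta}_\varphi$ also denotes its unique bounded extension $K_\alpha\to K_\beta$. Theorem. Let $\alpha,\beta$ be two nonconstant inner functions, let $\varphi\in L^2(\partial\mathbb{D})$, and suppose that $A^{\alpha,\beta}_\varphi:K_\alpha\to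 K_\beta$ is bounded. Then $A^{\alpha,\beta}_\varphi=0$ if and only if $\varphi\in\overline{\alpha H^2}+\beta H^2$, that is, if and only if there are $h_1,h_2\in H^2$ with $\varphi=\overline{\alpha h_1}+\beta h_2$ a.e. on $\partial\mathbb{D}$. -/

import Mathlib

open MeasureTheory AddCircle
open scoped ComplexConjugate ENNReal

noncomputable section

namespace ATTO

/-- Normalized arc length measure on the unit circle `∂𝔻`. The circle is parametrized by
`t ∈ ℝ/ℤ` through `t ↦ e^{2πit}`, which is `AddCircle.toCircle t`. -/
abbrev arc : Measure UnitAddCircle := haarAddCircle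

/-- The Hilbert space `L²(∂𝔻)`. -/
abbrev L2 : Type := Lp ℂ 2 arc

/-- The radial boundary function of a function on the unit disk: at the point `e^{2πit}` its value
is the limit of `u (r e^{2πit})` as `r ↑ 1` (meaningful where this limit exists, which is the case
at almost every `t` if `u` is inner in the sense below). -/
def boundary (u : ℂ → ℂ) (t : UnitAddCircle) : ℂ :=
  Filter.limUnder (nhdsWithin (1 : ℝ) (Set.Iio 1)) fun r : ℝ => u ((r : ℂ) * (toCircle t : ℂ))

/-- `u` is an inner function: a bounded analytic function on the open unit disk whose radial limits
exist and have modulus one at almost every point of the unit circle. (Only the values of `u` on the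
disk matter.) -/
structure IsInner (u : ℂ → ℂ) : Prop where
  analytic : DifferentiableOn ℂ u (Metric.ball 0 1)
  bounded : ∃ C : ℝ, ∀ z ∈ Metric.ball (0 : ℂ) 1, ‖u z‖ ≤ C
  unimodular : ∀ᵐ t ∂arc, ∃ c : ℂ, ‖c‖ = 1 ∧
    Filter.Tendsto (fun r : ℝ => u ((r : ℂ) * (toCircle t : ℂ)))
      (nhdsWithin (1 : ℝ) (Set.Iio 1)) (nhds c)

/-- `u` is not constant on the open unit disk. -/
def Nonconstant (u : ℂ → ℂ) : Prop :=
  ¬ ∃ c : ℂ, ∀ z ∈ Metric.ball (0 : ℂ) 1, u z = c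

/-- The Hardy space `H²`, identified through boundary values with the subspace of `L²(∂𝔻)` of the
functions whose Fourier coefficients with negative indices vanish. -/
def H2 : Submodule ℂ L2 where
  carrier := {f | ∀ n : ℤ, n < 0 → fourierCoeff f n = 0}
  zero_mem' := fun n _ => by
    rw [← fourierBasis_repr]; simp
  add_mem' := fun {f g} hf hg n hn => by
    have h1 := hf n hn
    have h2 := hg n hn
    rw [← fourierBasis_repr] at h1 h2 ⊢
    simp [h1, h2]
  smul_mem' := fun c f hf n hn => by
    have h1 := hf n hn
    rw [← fourierBasis_repr] at h1 ⊢
    simp [h1]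

/-- The subspace `u H²` of `L²(∂𝔻)`: all products of the boundary function of `u` with functions
in `H²`. -/
def mulH2 (u : ℂ → ℂ) : Submodule ℂ L2 where
  carrier := {f | ∃ h ∈ H2, f =ᵐ[arc] fun t => boundary u t * h t}
  zero_mem' := ⟨0, H2.zero_mem, by
    exact Filter.Eventually.of_forall fun t => by simp⟩
  add_mem' := by
    rintro f g ⟨h, hh, hf⟩ ⟨k, hk, hg⟩
    refine ⟨h + k, H2.add_mem hh hk, ?_⟩
    filter_upwards [hf, hg, Lp.coeFn_add f g, Lp.coeFn_add h k] with t h1 h2 h3 h4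
    rw [h3, h4, Pi.add_apply, Pi.add_apply, h1, h2, mul_add]
  smul_mem' := by
    rintro c f ⟨h, hh, hf⟩
    refine ⟨c • h, H2.smul_mem c hh, ?_⟩
    filter_upwards [hf, Lp.coeFn_smul c f, Lp.coeFn_smul c h] with t h1 h2 h3
    rw [h2, h3, Pi.smul_apply, Pi.smul_apply, h1, smul_eq_mul, smul_eq_mul]
    ring

/-- The model space `K_u = H² ⊖ u H²`. -/
def K (u : ℂ → ℂ) : Submodule ℂ L2 := H2 ⊓ (mulH2 u)ᗮ

theorem isClosed_H2 : IsClosed (H2 : Set L2) := by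
  have h : (H2 : Set L2) =
      ⋂ n : ℤ, ⋂ _ : n < 0, {f : L2 | inner ℂ (fourierBasis (T := 1) n) f = 0} := by
    ext f
    simp only [Set.mem_iInter, Set.mem_ofPred_eq, ← HilbertBasis.repr_apply_apply,
      fourierBasis_repr]
    rfl
  rw [h]
  exact isClosed_iInter fun n => isClosed_iInter fun _ =>
    isClosed_eq (by fun_prop) continuous_const

instance (u : ℂ → ℂ) : CompleteSpace (K u) := by
  have h : IsClosed (K u : Set L2) := isClosed_H2.inter (Submodule.isClosed_orthogonal _)
  exact h.completeSpace_coe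

/-- The orthogonal projection `P_u` of `L²(∂𝔻)` onto the model space `K_u`. -/
def P (u : ℂ → ℂ) : L2 →L[ℂ] K u := (K u).orthogonalProjectionOnto

/-- The subspace `K_u^∞ = K_u ∩ H^∞` of the (essentially) bounded functions in `K_u`. -/
def Kbdd (u : ℂ → ℂ) : Submodule ℂ (K u) where
  carrier := {f | MemLp (f : L2) ∞ arc}
  zero_mem' := (memLp_congr_ae (Lp.coeFn_zero ℂ 2 arc)).2 MemLp.zero'
  add_mem' := fun {f g} hf hg =>
    (memLp_congr_ae (Lp.coeFn_add (f : L2) (g : L2))).2 (MemLp.add hf hg)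
  smul_mem' := fun c f hf =>
    (memLp_congr_ae (Lp.coeFn_smul c (f : L2))).2 (MemLp.const_smul hf c)

/-- The product `φ f ∈ L²(∂𝔻)` of `φ ∈ L²(∂𝔻)` and a bounded `f ∈ K_u`. -/
def prod {u : ℂ → ℂ} (φ : L2) (f : Kbdd u) : L2 :=
  MemLp.toLp (fun t => φ t * ((f : K u) : L2) t)
    (MemLp.mul (p := 2) (q := ∞) f.2 (Lp.memLp φ))

/-- The asymmetric truncated Toeplitz operator `A_φ^{α,β} f = P_β (φ f)` with symbol
`φ ∈ L²(∂𝔻)`, as a densely defined operator from `K_α` to `K_β` with domain `K_α^∞`. -/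
def toeplitz (α β : ℂ → ℂ) (φ : L2) : K α →ₗ.[ℂ] K β where
  domain := Kbdd α
  toFun :=
    { toFun := fun f => P β (prod φ f)
      map_add' := fun f g => by
        rw [← map_add]
        congr 1
        apply Lp.ext
        filter_upwards [Lp.coeFn_add (prod φ f) (prod φ g), MemLp.coeFn_toLp
          (MemLp.mul (p := 2) (q := ∞) (r := 2) f.2 (Lp.memLp φ)), MemLp.coeFn_toLp
          (MemLp.mul (p := 2) (q := ∞) (r := 2) g.2 (Lp.memLp φ)), MemLp.coeFn_toLp
          (MemLp.mul (p := 2) (q := ∞) (r := 2) (f + g).2 (Lp.memLp φ)),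
          Lp.coeFn_add ((f : K α) : L2) ((g : K α) : L2)] with t h1 h2 h3 h4 h5
        refine h4.trans (Eq.trans ?_ (h1.trans (congrArg₂ (· + ·) h2 h3)).symm)
        exact (congrArg (φ t * ·) h5).trans (mul_add _ _ _)
      map_smul' := fun c f => by
        rw [RingHom.id_apply, ← map_smul]
        congr 1
        apply Lp.ext
        filter_upwards [Lp.coeFn_smul c (prod φ f), MemLp.coeFn_toLp
          (MemLp.mul (p := 2) (q := ∞) (r := 2) f.2 (Lp.memLp φ)), MemLp.coeFn_toLp
          (MemLp.mul (p := 2) (q := ∞) (r := 2) (c • f).2 (Lp.memLp φ)),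
          Lp.coeFn_smul c ((f : K α) : L2)] with t h1 h2 h3 h4
        refine h3.trans (Eq.trans ?_ (h1.trans (congrArg (c • ·) h2)).symm)
        exact (congrArg (φ t * ·) h4).trans (mul_left_comm _ _ _) }

/-- `A : K_α → K_β` is the bounded asymmetric truncated Toeplitz operator `A_φ^{α,β}`: it is a
bounded linear operator on all of `K_α` that agrees with the densely defined operator
`f ↦ P_β (φ f)`. -/
def IsBoundedToeplitz (α β : ℂ → ℂ) (φ : L2) (A : K α →L[ℂ] K β) : Prop :=
  ∀ f : (toeplitz α β φ).domain, A f = toeplitz α β φ f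

end ATTO

end

/-! Since $K_\alpha^\infty$ is dense (`IsInner.dense_Kbdd`), $A=0$ means $\langle g,\varphi
f\rangle=0$ for all $f\in K_\alpha^\infty$, $g\in K_\beta$. If $\varphi=\overline{\alpha h_1}+\beta
h_2$, then $f\,\overline{\alpha h_1}$ has only negative frequencies because $f\perp\alpha z^nh_1$
for $n\ge 0$, while $f\beta h_2\in\beta H^2$; both are orthogonal to $K_\beta$.

The converse rests on the backward shift $S^*f=\bar z(f-f(0))$, which preserves model spaces and
boundedness. As $\bar z$ is unimodular, $\langle S^*g,\varphi S^*f\rangle=\langle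
g-g(0),\varphi(f-f(0))\rangle$. Expanding (`inner_backwardShift`) and dropping the pairings that
vanish by hypothesis leaves $f(0)\langle
g,\varphi\rangle+\overline{g(0)}\langle\bar\varphi,f\rangle=\overline{g(0)}f(0)\,\hat\varphi(0)$.
Nonconstancy supplies $f_0,g_0$ not vanishing at $0$, so the variables separate: $\varphi-c\perp
K_\beta$ and $\bar\varphi-\overline{(\hat\varphi(0)-c)}\perp K_\alpha$ for one constant $c$. By
`IsInner.mem_mulH2_of_orthogonal` the Riesz projections of these two functions lie in $\beta H^2$
and $\alpha H^2$, and they reassemble $\varphi$. -/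

namespace ATTO

/-! ### Multiplication by bounded functions on `L²` -/

/-- Multiplication by an essentially bounded function, as a linear map on `L²(∂𝔻)`. -/
noncomputable def mulBdd (u : UnitAddCircle → ℂ) (hu : MemLp u ∞ arc) : L2 →ₗ[ℂ] L2 where
  toFun f := MemLp.toLp (fun t => u t * f t) (MemLp.mul (p := ∞) (q := 2) (Lp.memLp f) hu)
  map_add' f g := by
    apply Lp.ext
    filter_upwards [MemLp.coeFn_toLp (MemLp.mul (p := ∞) (q := 2) (r := 2) (Lp.memLp (f + g)) hu),
      MemLp.coeFn_toLp (MemLp.mul (p := ∞) (q := 2) (r := 2) (Lp.memLp f) hu),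
      MemLp.coeFn_toLp (MemLp.mul (p := ∞) (q := 2) (r := 2) (Lp.memLp g) hu),
      Lp.coeFn_add (MemLp.toLp _ (MemLp.mul (p := ∞) (q := 2) (r := 2) (Lp.memLp f) hu))
        (MemLp.toLp _ (MemLp.mul (p := ∞) (q := 2) (r := 2) (Lp.memLp g) hu)),
      Lp.coeFn_add f g] with t h1 h2 h3 h4 h5
    refine h1.trans (Eq.trans ?_ (h4.trans (congrArg₂ (· + ·) h2 h3)).symm)
    exact (congrArg (u t * ·) h5).trans (mul_add _ _ _)
  map_smul' c f := by
    apply Lp.ext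
    filter_upwards [MemLp.coeFn_toLp (MemLp.mul (p := ∞) (q := 2) (r := 2) (Lp.memLp (c • f)) hu),
      MemLp.coeFn_toLp (MemLp.mul (p := ∞) (q := 2) (r := 2) (Lp.memLp f) hu),
      Lp.coeFn_smul c (MemLp.toLp _ (MemLp.mul (p := ∞) (q := 2) (r := 2) (Lp.memLp f) hu)),
      Lp.coeFn_smul c f] with t h1 h2 h3 h4
    refine h1.trans (Eq.trans ?_ (h3.trans (congrArg (c • ·) h2)).symm)
    exact (congrArg (u t * ·) h4).trans (mul_left_comm _ _ _)

theorem coeFn_mulBdd (u : UnitAddCircle → ℂ) (hu : MemLp u ∞ arc) (f : L2) :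
    mulBdd u hu f =ᵐ[arc] fun t => u t * f t :=
  MemLp.coeFn_toLp (MemLp.mul (p := ∞) (q := 2) (r := 2) (Lp.memLp f) hu)

theorem mulBdd_comm {u v : UnitAddCircle → ℂ} (hu : MemLp u ∞ arc) (hv : MemLp v ∞ arc) (f : L2) :
    mulBdd u hu (mulBdd v hv f) = mulBdd v hv (mulBdd u hu f) := by
  apply Lp.ext
  filter_upwards [coeFn_mulBdd u hu (mulBdd v hv f), coeFn_mulBdd v hv f,
    coeFn_mulBdd v hv (mulBdd u hu f), coeFn_mulBdd u hu f] with t h1 h2 h3 h4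
  rw [h1, h2, h3, h4, mul_left_comm]

theorem memLp_top_conj {u : UnitAddCircle → ℂ} (hu : MemLp u ∞ arc) :
    MemLp (fun t => conj (u t)) ∞ arc :=
  hu.star

theorem mulBdd_conj_mulBdd {u : UnitAddCircle → ℂ} (hu : MemLp u ∞ arc)
    (h1 : ∀ᵐ t ∂arc, ‖u t‖ = 1) (f : L2) :
    mulBdd _ (memLp_top_conj hu) (mulBdd u hu f) = f := by
  apply Lp.ext
  filter_upwards [coeFn_mulBdd u hu f, coeFn_mulBdd _ (memLp_top_conj hu) (mulBdd u hu f), h1]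
    with t h2 h3 h4
  rw [h3, h2, ← mul_assoc, Complex.conj_mul', h4]
  simp

theorem inner_mulBdd_left {u : UnitAddCircle → ℂ} (hu : MemLp u ∞ arc) (f g : L2) :
    inner ℂ (mulBdd u hu f) g = inner ℂ f (mulBdd _ (memLp_top_conj hu) g) := by
  rw [L2.inner_def, L2.inner_def]
  apply integral_congr_ae
  filter_upwards [coeFn_mulBdd u hu f, coeFn_mulBdd _ (memLp_top_conj hu) g] with t h1 h2
  rw [h1, h2]
  simp only [RCLike.inner_apply', map_mul]
  ring

theorem inner_mulBdd_mulBdd {u : UnitAddCircle → ℂ} (hu : MemLp u ∞ arc)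
    (h1 : ∀ᵐ t ∂arc, ‖u t‖ = 1) (f g : L2) :
    inner ℂ (mulBdd u hu f) (mulBdd u hu g) = inner ℂ f g := by
  rw [inner_mulBdd_left, mulBdd_conj_mulBdd hu h1]

/-! ### Monomials and the Hardy space -/

/-- The monomial `zⁿ` as an element of `L²(∂𝔻)`. -/
noncomputable def monomial (n : ℤ) : L2 := fourierBasis (T := 1) n

theorem coeFn_monomial (n : ℤ) : monomial n =ᵐ[arc] fourier n := by
  rw [monomial, coe_fourierBasis]
  exact coeFn_fourierLp 2 n

theorem inner_monomial (n : ℤ) (f : L2) : inner ℂ (monomial n) f = fourierCoeff f n := by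
  rw [← fourierBasis_repr, HilbertBasis.repr_apply_apply, monomial]

theorem norm_fourier_apply (n : ℤ) (t : UnitAddCircle) : ‖fourier n t‖ = 1 := by
  rw [fourier_apply, Circle.norm_coe]

theorem memLp_top_fourier (n : ℤ) : MemLp (fun t : UnitAddCircle => fourier n t) ∞ arc :=
  memLp_top_of_bound (map_continuous (fourier n)).aestronglyMeasurable 1
    (Filter.Eventually.of_forall fun t => (norm_fourier_apply n t).le)

/-- Multiplication by `zⁿ` on `L²(∂𝔻)`. -/
noncomputable abbrev shift (n : ℤ) : L2 →ₗ[ℂ] L2 := mulBdd _ (memLp_top_fourier n)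

theorem fourierCoeff_mulBdd {u : UnitAddCircle → ℂ} (hu : MemLp u ∞ arc) (f : L2) (n : ℤ) :
    fourierCoeff (mulBdd u hu f) n = fourierCoeff (fun t => u t * f t) n :=
  congrFun (fourierCoeff_congr_ae (coeFn_mulBdd u hu f)) n

theorem fourierCoeff_fourier_mul (f : UnitAddCircle → ℂ) (m n : ℤ) :
    fourierCoeff (fun t => fourier m t * f t) n = fourierCoeff f (n - m) := by
  simp only [fourierCoeff, smul_eq_mul]
  congr 1
  ext t
  rw [← mul_assoc, ← fourier_add, show -n + m = -(n - m) by ring]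

theorem fourierCoeff_shift (f : L2) (m n : ℤ) :
    fourierCoeff (shift m f) n = fourierCoeff f (n - m) := by
  rw [fourierCoeff_mulBdd, fourierCoeff_fourier_mul]

theorem inner_shift_shift (n : ℤ) (f g : L2) :
    inner ℂ (shift n f) (shift n g) = inner ℂ f g :=
  inner_mulBdd_mulBdd _ (Filter.Eventually.of_forall (norm_fourier_apply n)) f g

theorem mulBdd_monomial {u : UnitAddCircle → ℂ} (hu : MemLp u ∞ arc) (n : ℤ) :
    mulBdd u hu (monomial n) =ᵐ[arc] fun t => fourier n t * u t := by
  filter_upwards [coeFn_mulBdd u hu (monomial n), coeFn_monomial n] with t h1 h2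
  rw [h1, h2, mul_comm]

theorem fourierCoeff_mulBdd_monomial {u : UnitAddCircle → ℂ} (hu : MemLp u ∞ arc) (m n : ℤ) :
    fourierCoeff (mulBdd u hu (monomial m)) n = fourierCoeff u (n - m) := by
  rw [fourierCoeff_congr_ae (mulBdd_monomial hu m), fourierCoeff_fourier_mul]

theorem fourierCoeff_conj (u : UnitAddCircle → ℂ) (n : ℤ) :
    fourierCoeff (fun t => conj (u t)) n = conj (fourierCoeff u (-n)) := by
  simp only [fourierCoeff, smul_eq_mul, ← integral_conj, map_mul, neg_neg]
  congr 1
  ext t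
  rw [fourier_neg]

theorem fourierCoeff_monomial (m n : ℤ) :
    fourierCoeff (monomial m) n = if n = m then 1 else 0 := by
  rw [← inner_monomial]
  exact (orthonormal_iff_ite.1 (fourierBasis (T := 1)).orthonormal) n m

theorem monomial_mem_H2 {n : ℤ} (hn : 0 ≤ n) : monomial n ∈ H2 := fun m hm => by
  rw [fourierCoeff_monomial, if_neg (by omega)]

theorem eq_zero_of_fourierCoeff {f : L2} (h : ∀ n, fourierCoeff f n = 0) : f = 0 := by
  apply (fourierBasis (T := 1)).repr.injective
  ext n
  rw [fourierBasis_repr, h, map_zero]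
  rfl

/-- Parseval: in each term one of the two coefficients vanishes. -/
theorem inner_eq_zero_of_mem_H2 {f g : L2} (hf : ∀ n : ℤ, 0 ≤ n → fourierCoeff f n = 0)
    (hg : g ∈ H2) : inner ℂ f g = 0 := by
  rw [← (fourierBasis (T := 1)).tsum_inner_mul_inner f g]
  refine (tsum_congr fun n => ?_).trans tsum_zero
  change inner ℂ f (monomial n) * inner ℂ (monomial n) g = 0
  rcases le_or_gt 0 n with hn | hn
  · rw [← inner_conj_symm, inner_monomial, hf n hn, map_zero, zero_mul]
  · rw [inner_monomial, hg n hn, mul_zero]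

/-- By duality, with no convolution of coefficients: for $n<0$ the $n$-th coefficient is
$\langle\bar u z^n,f\rangle$, and $\bar u z^n$ has only negative frequencies. -/
theorem mulBdd_mem_H2 {u : UnitAddCircle → ℂ} (hu : MemLp u ∞ arc)
    (hu0 : ∀ n : ℤ, n < 0 → fourierCoeff u n = 0) {f : L2} (hf : f ∈ H2) :
    mulBdd u hu f ∈ H2 := fun n hn => by
  rw [← inner_monomial, ← inner_conj_symm, inner_mulBdd_left, ← inner_conj_symm,
    inner_eq_zero_of_mem_H2 (fun k hk => ?_) hf, map_zero, map_zero]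
  rw [fourierCoeff_mulBdd_monomial, fourierCoeff_conj, hu0 _ (by omega), map_zero]

theorem shift_mem_H2 {n : ℤ} (hn : 0 ≤ n) {f : L2} (hf : f ∈ H2) : shift n f ∈ H2 :=
  fun m hm => by rw [fourierCoeff_shift, hf _ (by omega)]

instance : CompleteSpace H2 := isClosed_H2.completeSpace_coe

theorem fourierCoeff_sub (f g : L2) (n : ℤ) :
    fourierCoeff (f - g : L2) n = fourierCoeff f n - fourierCoeff g n := by
  simp only [← inner_monomial, inner_sub_right]

/-- The Riesz projection of `L²(∂𝔻)` onto `H²`. -/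
noncomputable def riesz (f : L2) : L2 := H2.orthogonalProjectionOnto f

theorem riesz_mem (f : L2) : riesz f ∈ H2 := (H2.orthogonalProjectionOnto f).2

theorem inner_riesz {h : L2} (hh : h ∈ H2) (f : L2) :
    inner ℂ h (riesz f) = inner ℂ h f :=
  Submodule.inner_orthogonalProjectionOnto_eq_of_mem_left ⟨h, hh⟩ f

theorem fourierCoeff_riesz {n : ℤ} (hn : 0 ≤ n) (f : L2) :
    fourierCoeff (riesz f) n = fourierCoeff f n := by
  rw [← inner_monomial, inner_riesz (monomial_mem_H2 hn), inner_monomial]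

theorem memLp_top_monomial (n : ℤ) : MemLp (monomial n) ∞ arc :=
  (memLp_congr_ae (coeFn_monomial n)).2 (memLp_top_fourier n)

/-- Functions in `L²` with finite Fourier expansion are bounded. -/
theorem memLp_top_of_fourierCoeff_eq_zero {f : L2} (s : Finset ℤ)
    (hf : ∀ n, n ∉ s → fourierCoeff f n = 0) : MemLp f ∞ arc := by
  have h : f = ∑ n ∈ s, fourierCoeff f n • monomial n := by
    have h1 := (fourierBasis (T := 1)).hasSum_repr f
    refine h1.unique (hasSum_sum_of_ne_finset_zero (s := s) fun n hn => ?_) |>.trans ?_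
    · rw [fourierBasis_repr, hf n hn, zero_smul]
    · exact Finset.sum_congr rfl fun n _ => by rw [fourierBasis_repr]; rfl
  rw [h]
  clear h hf
  induction s using Finset.induction_on with
  | empty => simpa using (memLp_congr_ae (Lp.coeFn_zero ℂ 2 arc)).2 MemLp.zero'
  | insert a s ha ih =>
    rw [Finset.sum_insert ha]
    exact (memLp_congr_ae (Lp.coeFn_add _ _)).2 (MemLp.add
      ((memLp_congr_ae (Lp.coeFn_smul _ _)).2 (MemLp.const_smul (memLp_top_monomial a) _)) ih)

theorem memLp_top_sub {f g : L2} (hf : MemLp f ∞ arc) (hg : MemLp g ∞ arc) :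
    MemLp (f - g : L2) ∞ arc :=
  (memLp_congr_ae (Lp.coeFn_sub _ _)).2 (hf.sub hg)

theorem memLp_top_smul (c : ℂ) {f : L2} (hf : MemLp f ∞ arc) : MemLp (c • f : L2) ∞ arc :=
  (memLp_congr_ae (Lp.coeFn_smul _ _)).2 (hf.const_smul c)

theorem memLp_top_mulBdd {u : UnitAddCircle → ℂ} (hu : MemLp u ∞ arc) {f : L2}
    (hf : MemLp f ∞ arc) : MemLp (mulBdd u hu f) ∞ arc :=
  (memLp_congr_ae (coeFn_mulBdd u hu f)).2 (MemLp.mul (p := ∞) (q := ∞) hf hu)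

/-! ### Boundary functions of inner functions -/

theorem integral_arc_eq_circleAverage (g : ℂ → ℂ) (r : ℝ) :
    ∫ t, g (r * (toCircle t : ℂ)) ∂arc = Real.circleAverage g 0 r := by
  have h := fourierCoeff_eq_intervalIntegral (T := 1)
    (fun t : UnitAddCircle => g (r * (toCircle t : ℂ))) 0 0
  simp only [fourierCoeff, neg_zero, fourier_zero, one_smul, div_one, zero_add] at h
  rw [h, Real.circleAverage_def]
  have h2 : ∀ x : ℝ, g (r * (toCircle (x : UnitAddCircle) : ℂ)) =
      (fun θ : ℝ => g (circleMap 0 r θ)) (2 * Real.pi * x) := fun x => by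
    rw [toCircle_apply_mk, Circle.coe_exp]
    simp [circleMap]
  simp only [h2]
  rw [intervalIntegral.integral_comp_mul_left (fun θ : ℝ => g (circleMap 0 r θ))
    (by positivity)]
  simp

theorem mul_toCircle_mem_ball {r : ℝ} (h0 : 0 < r) (h1 : r < 1) (t : UnitAddCircle) :
    (r : ℂ) * (toCircle t : ℂ) ∈ Metric.ball (0 : ℂ) 1 := by
  rw [mem_ball_zero_iff, norm_mul, Circle.norm_coe, mul_one, Complex.norm_real, Real.norm_eq_abs,
    abs_of_pos h0]
  exact h1

theorem continuous_coe_toCircle : Continuous fun t : UnitAddCircle => (toCircle t : ℂ) :=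
  continuous_subtype_val.comp continuous_toCircle

/-- Cauchy's integral formula for a bounded analytic function in terms of its radial boundary
values. -/
theorem integral_cauchy_boundary {u : ℂ → ℂ} (hu : DifferentiableOn ℂ u (Metric.ball 0 1))
    {C : ℝ} (hC : ∀ z ∈ Metric.ball (0 : ℂ) 1, ‖u z‖ ≤ C) {v : UnitAddCircle → ℂ}
    (hv : ∀ᵐ t ∂arc, Filter.Tendsto (fun r : ℝ => u ((r : ℂ) * (toCircle t : ℂ)))
      (nhdsWithin (1 : ℝ) (Set.Iio 1)) (nhds (v t)))
    {w : ℂ} (hw : w ∈ Metric.ball (0 : ℂ) 1) :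
    ∫ t, (toCircle t : ℂ) / ((toCircle t : ℂ) - w) * v t ∂arc = u w := by
  rw [mem_ball_zero_iff] at hw
  -- Beyond the midpoint of $|w|$ and $1$, the circle of radius $r$ stays at distance at least
  -- $(1-|w|)/2$ from $w$, which dominates the Cauchy kernels uniformly in $r$.
  have hnear : ∀ᶠ r : ℝ in nhdsWithin (1 : ℝ) (Set.Iio 1), (1 + ‖w‖) / 2 < r ∧ r < 1 :=
    (((lt_mem_nhds (by linarith : (1 + ‖w‖) / 2 < 1)).filter_mono nhdsWithin_le_nhds).and
      self_mem_nhdsWithin)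
  have hden : ∀ r : ℝ, (1 + ‖w‖) / 2 < r → ∀ t : UnitAddCircle,
      (1 - ‖w‖) / 2 ≤ ‖(r : ℂ) * (toCircle t : ℂ) - w‖ := fun r hr t => by
    have h := norm_sub_norm_le ((r : ℂ) * (toCircle t : ℂ)) w
    rw [norm_mul, Circle.norm_coe, mul_one, Complex.norm_real, Real.norm_eq_abs] at h
    linarith [le_abs_self r]
  have hC0 : 0 ≤ C := (norm_nonneg _).trans (hC 0 (by simp))
  have hw0 := norm_nonneg w
  have hlim : Filter.Tendsto (fun r : ℝ => ∫ t : UnitAddCircle, ((r : ℂ) * (toCircle t : ℂ)) /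
      ((r : ℂ) * (toCircle t : ℂ) - w) * u ((r : ℂ) * (toCircle t : ℂ)) ∂arc)
      (nhdsWithin (1 : ℝ) (Set.Iio 1))
      (nhds (∫ t, (toCircle t : ℂ) / ((toCircle t : ℂ) - w) * v t ∂arc)) := by
    refine tendsto_integral_filter_of_dominated_convergence
      (fun _ => 1 / ((1 - ‖w‖) / 2) * C) ?_ ?_ (integrable_const _) ?_
    · filter_upwards [hnear] with r hr
      refine Continuous.aestronglyMeasurable ?_
      have hc : Continuous fun t : UnitAddCircle => (r : ℂ) * (toCircle t : ℂ) :=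
        continuous_const.mul continuous_coe_toCircle
      refine (hc.div (hc.sub continuous_const) fun t h => ?_).mul
        (hu.continuousOn.comp_continuous hc fun t =>
          mul_toCircle_mem_ball (by linarith [hr.1]) hr.2 t)
      have h2 := hden r hr.1 t
      rw [show (r : ℂ) * (toCircle t : ℂ) - w = 0 from h, norm_zero] at h2
      linarith
    · filter_upwards [hnear] with r hr
      refine Filter.Eventually.of_forall fun t => ?_
      rw [norm_mul, norm_div]
      have h2 := hden r hr.1 t
      have h3 := mul_toCircle_mem_ball (by linarith [hr.1] : 0 < r) hr.2 t
      refine mul_le_mul (div_le_div₀ zero_le_one (mem_ball_zero_iff.1 h3).le (by linarith) h2)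
        (hC _ h3) (norm_nonneg _) (by positivity)
    · filter_upwards [hv] with t ht
      have h1 : Filter.Tendsto (fun r : ℝ => (r : ℂ) * (toCircle t : ℂ))
          (nhdsWithin (1 : ℝ) (Set.Iio 1)) (nhds (toCircle t : ℂ)) := by
        have h : Continuous fun r : ℝ => (r : ℂ) * (toCircle t : ℂ) := by fun_prop
        simpa using (h.tendsto 1).mono_left nhdsWithin_le_nhds
      refine (h1.div (h1.sub_const w) fun h => ?_).mul ht
      have h2 := congrArg norm (sub_eq_zero.1 h)
      rw [Circle.norm_coe] at h2
      linarith
  -- By Cauchy's formula on the circle of radius $r$, the integrals already equal $u(w)$ for every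
  -- $r$ near $1$.
  refine tendsto_nhds_unique hlim (tendsto_const_nhds.congr' ?_)
  filter_upwards [hnear] with r hr
  have hr0 : 0 < r := by linarith [hr.1]
  rw [integral_arc_eq_circleAverage (fun z => z / (z - w) * u z) r]
  have hd : DiffContOnCl ℂ u (Metric.ball 0 |r|) := by
    refine (hu.mono ?_).diffContOnCl
    rw [closure_ball _ (abs_pos.2 hr0.ne').ne', abs_of_pos hr0]
    exact Metric.closedBall_subset_ball hr.2
  rw [← hd.circleAverage_smul_div (w := w)]
  · simp only [sub_zero, smul_eq_mul]
  · rw [mem_ball_zero_iff, abs_of_pos hr0]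
    linarith [hr.1]

namespace IsInner

variable {u : ℂ → ℂ}

theorem tendsto_boundary (hu : IsInner u) : ∀ᵐ t ∂arc, Filter.Tendsto
    (fun r : ℝ => u ((r : ℂ) * (toCircle t : ℂ))) (nhdsWithin (1 : ℝ) (Set.Iio 1))
      (nhds (boundary u t)) := by
  filter_upwards [hu.unimodular] with t ⟨c, _, hc⟩
  rw [boundary, hc.limUnder_eq]
  exact hc

theorem norm_boundary (hu : IsInner u) : ∀ᵐ t ∂arc, ‖boundary u t‖ = 1 := by
  filter_upwards [hu.unimodular] with t ⟨c, h, hc⟩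
  rw [boundary, hc.limUnder_eq, h]

theorem memLp_boundary (hu : IsInner u) : MemLp (boundary u) ∞ arc := by
  refine memLp_top_of_bound ?_ 1 (hu.norm_boundary.mono fun t ht => ht.le)
  obtain ⟨r, _, hr, hr1⟩ := exists_seq_strictMono_tendsto' (zero_lt_one' ℝ)
  refine aestronglyMeasurable_of_tendsto_ae Filter.atTop
    (f := fun n t => u ((r n : ℂ) * (toCircle t : ℂ))) (fun n => ?_) ?_
  · exact (hu.analytic.continuousOn.comp_continuous
      (continuous_const.mul continuous_coe_toCircle) fun t =>
        mul_toCircle_mem_ball (hr n).1 (hr n).2 t).aestronglyMeasurable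
  · filter_upwards [hu.tendsto_boundary] with t ht
    exact ht.comp (tendsto_nhdsWithin_iff.2 ⟨hr1, Filter.Eventually.of_forall fun n => (hr n).2⟩)

/-- For $n=-(k+1)$ the coefficient is the Cauchy integral at $0$ of $z^{k+1}u$, which vanishes
there. -/
theorem fourierCoeff_boundary (hu : IsInner u) {n : ℤ} (hn : n < 0) :
    fourierCoeff (boundary u) n = 0 := by
  obtain ⟨k, rfl⟩ : ∃ k : ℕ, n = -((k : ℤ) + 1) := ⟨(-n - 1).toNat, by omega⟩
  obtain ⟨C, hC⟩ := hu.bounded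
  have h := integral_cauchy_boundary (u := fun z => z ^ (k + 1) * u z) (C := C)
    (v := fun t => (toCircle t : ℂ) ^ (k + 1) * boundary u t) (w := 0)
    ((differentiableOn_id.pow _).mul hu.analytic) (fun z hz => ?_) ?_ (by simp)
  · simp only [sub_zero, ne_eq, Nat.add_eq_zero_iff, one_ne_zero, and_false, not_false_eq_true,
      zero_pow, zero_mul] at h
    rw [← h, fourierCoeff]
    congr 1
    ext t
    rw [div_self (Circle.coe_ne_zero _), one_mul, neg_neg, fourier_apply, toCircle_zsmul,
      smul_eq_mul]
    norm_cast
  · rw [norm_mul, norm_pow]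
    exact (mul_le_of_le_one_left (norm_nonneg _)
      (pow_le_one₀ (norm_nonneg _) (mem_ball_zero_iff.1 hz).le)).trans (hC z hz)
  · filter_upwards [hu.tendsto_boundary] with t ht
    refine Filter.Tendsto.mul ?_ ht
    have h : Continuous fun r : ℝ => ((r : ℂ) * (toCircle t : ℂ)) ^ (k + 1) := by fun_prop
    simpa using (h.tendsto 1).mono_left nhdsWithin_le_nhds

theorem not_ae_eq_const (hu : IsInner u) (hu' : Nonconstant u) (c : ℂ) :
    ¬ ∀ᵐ t ∂arc, boundary u t = c := fun h => by
  refine hu' ⟨c, fun w hw => ?_⟩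
  obtain ⟨C, hC⟩ := hu.bounded
  rw [← integral_cauchy_boundary hu.analytic hC hu.tendsto_boundary hw,
    ← integral_cauchy_boundary (u := fun _ => c) (v := fun _ => c) (differentiableOn_const c)
      (fun _ _ => le_rfl) (Filter.Eventually.of_forall fun t => tendsto_const_nhds) hw]
  apply integral_congr_ae
  filter_upwards [h] with t ht
  rw [ht]

end IsInner

/-! ### Model spaces -/

namespace IsInner

variable {u : ℂ → ℂ}

/-- Multiplication by an inner function on `L²(∂𝔻)`. -/
noncomputable abbrev mul (hu : IsInner u) : L2 →ₗ[ℂ] L2 := mulBdd _ hu.memLp_boundary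

theorem mem_mulH2 (hu : IsInner u) {f : L2} : f ∈ mulH2 u ↔ ∃ h ∈ H2, f = hu.mul h := by
  constructor
  · rintro ⟨h, hh, hf⟩
    exact ⟨h, hh, Lp.ext (hf.trans (coeFn_mulBdd _ hu.memLp_boundary h).symm)⟩
  · rintro ⟨h, hh, rfl⟩
    exact ⟨h, hh, coeFn_mulBdd _ hu.memLp_boundary h⟩

theorem mul_mem_H2 (hu : IsInner u) {f : L2} (hf : f ∈ H2) : hu.mul f ∈ H2 :=
  mulBdd_mem_H2 _ (fun _ hn => hu.fourierCoeff_boundary hn) hf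

theorem mem_K (hu : IsInner u) {f : L2} :
    f ∈ K u ↔ f ∈ H2 ∧ ∀ h ∈ H2, inner ℂ (hu.mul h) f = 0 := by
  rw [K, Submodule.mem_inf, Submodule.mem_orthogonal]
  refine and_congr_right fun _ => ⟨fun h g hg => h _ (hu.mem_mulH2.2 ⟨g, hg, rfl⟩), ?_⟩
  rintro h _ hg
  obtain ⟨g, hgH, rfl⟩ := hu.mem_mulH2.1 hg
  exact h g hgH

/-- The function `P₊(ū f)`, so that `u P₊(ū f)` is the projection of `f` onto `u H²`. -/
noncomputable def quotient (hu : IsInner u) (f : L2) : L2 :=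
  riesz (mulBdd _ (memLp_top_conj hu.memLp_boundary) f)

theorem quotient_mem (hu : IsInner u) (f : L2) : hu.quotient f ∈ H2 := riesz_mem _

/-- Multiplication by $u$ is isometric, so $\langle uh,uP_+(\bar uf)\rangle=\langle h,\bar
uf\rangle=\langle uh,f\rangle$. -/
theorem sub_mul_quotient_mem_K (hu : IsInner u) {f : L2} (hf : f ∈ H2) :
    f - hu.mul (hu.quotient f) ∈ K u := by
  refine hu.mem_K.2 ⟨H2.sub_mem hf (hu.mul_mem_H2 (hu.quotient_mem f)), fun h hh => ?_⟩
  rw [inner_sub_right, inner_mulBdd_mulBdd _ hu.norm_boundary, quotient, inner_riesz hh,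
    inner_mulBdd_left, sub_self]

/-- The difference $f-uP_+(\bar uf)$ lies in $K_u$, hence is orthogonal to both of its terms and so
to itself. Closedness of $uH^2$ is not needed. -/
theorem mem_mulH2_of_orthogonal (hu : IsInner u) {f : L2} (hf : f ∈ H2)
    (h : ∀ g ∈ K u, inner ℂ g f = 0) : f ∈ mulH2 u := by
  have h1 := hu.sub_mul_quotient_mem_K hf
  have h2 : inner ℂ (f - hu.mul (hu.quotient f)) (f - hu.mul (hu.quotient f)) = 0 := by
    rw [inner_sub_right, h _ h1, ← inner_conj_symm,
      (hu.mem_K.1 h1).2 _ (hu.quotient_mem f), map_zero, sub_zero]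
  exact hu.mem_mulH2.2 ⟨_, hu.quotient_mem f, sub_eq_zero.1 (inner_self_eq_zero.1 h2)⟩

/-- The projection of `zⁿ` onto the model space `K_u`. -/
noncomputable def projMonomial (hu : IsInner u) (n : ℕ) : L2 :=
  monomial n - hu.mul (hu.quotient (monomial n))

theorem projMonomial_mem_K (hu : IsInner u) (n : ℕ) : hu.projMonomial n ∈ K u :=
  hu.sub_mul_quotient_mem_K (monomial_mem_H2 n.cast_nonneg)

/-- $\bar uz^n$ has no frequency above $n$, so $P_+(\bar uz^n)$ is a polynomial; this is what makes
`projMonomial` bounded. -/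
theorem fourierCoeff_quotient_monomial (hu : IsInner u) (n : ℕ) (k : ℤ)
    (hk : k ∉ Finset.Icc (0 : ℤ) n) : fourierCoeff (hu.quotient (monomial n)) k = 0 := by
  rw [Finset.mem_Icc, not_and_or, not_le, not_le] at hk
  rcases lt_or_ge k 0 with h | h
  · exact hu.quotient_mem _ k h
  · rw [quotient, fourierCoeff_riesz h, fourierCoeff_mulBdd_monomial, fourierCoeff_conj,
      hu.fourierCoeff_boundary (by omega), map_zero]

theorem memLp_top_projMonomial (hu : IsInner u) (n : ℕ) : MemLp (hu.projMonomial n) ∞ arc :=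
  memLp_top_sub (memLp_top_monomial n) (memLp_top_mulBdd _
    (memLp_top_of_fourierCoeff_eq_zero _ (hu.fourierCoeff_quotient_monomial n)))

theorem inner_projMonomial (hu : IsInner u) (n : ℕ) {f : L2} (hf : f ∈ K u) :
    inner ℂ (hu.projMonomial n) f = fourierCoeff f n := by
  rw [projMonomial, inner_sub_left, (hu.mem_K.1 hf).2 _ (hu.quotient_mem _), sub_zero,
    inner_monomial]

/-- The bounded functions `projMonomial` reproduce the Fourier coefficients on $K_u$, so only $0$ is
orthogonal to all of them. -/
theorem dense_Kbdd (hu : IsInner u) : Dense (Kbdd u : Set (K u)) := by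
  rw [Submodule.dense_iff_topologicalClosure_eq_top, Submodule.topologicalClosure_eq_top_iff,
    Submodule.eq_bot_iff]
  rintro ⟨f, hf⟩ h
  refine Subtype.ext (eq_zero_of_fourierCoeff fun n => ?_)
  rcases lt_or_ge n 0 with hn | hn
  · exact hf.1 n hn
  · lift n to ℕ using hn
    rw [← hu.inner_projMonomial n hf]
    exact h ⟨_, hu.projMonomial_mem_K n⟩ (hu.memLp_top_projMonomial n)

/-- The value at $0$ is the squared norm of the projection of $1$. If it vanished, then $1=uq$ with
$q$ a polynomial of degree $0$, forcing $u$ to be constant. -/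
theorem fourierCoeff_projMonomial_zero_ne_zero (hu : IsInner u) (hu' : Nonconstant u) :
    fourierCoeff (hu.projMonomial 0) 0 ≠ 0 := fun h => by
  have h1 := hu.inner_projMonomial 0 (hu.projMonomial_mem_K 0)
  rw [Nat.cast_zero, h, inner_self_eq_zero, projMonomial, sub_eq_zero] at h1
  set q := hu.quotient (monomial (0 : ℕ)) with hq
  have h2 : q = fourierCoeff q 0 • monomial 0 := by
    rw [← sub_eq_zero]
    refine eq_zero_of_fourierCoeff fun n => ?_
    rw [← inner_monomial, inner_sub_right, inner_smul_right, inner_monomial, inner_monomial,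
      fourierCoeff_monomial]
    split_ifs with hn
    · rw [hn, mul_one, sub_self]
    · rw [hq, hu.fourierCoeff_quotient_monomial 0 n (by simpa using hn), mul_zero, sub_zero]
  rw [h2, map_smul] at h1
  refine hu.not_ae_eq_const hu' (fourierCoeff q 0)⁻¹ ?_
  have h3 := Lp.coeFn_smul (fourierCoeff q 0) (hu.mul (monomial 0))
  rw [← h1] at h3
  filter_upwards [h3, mulBdd_monomial hu.memLp_boundary 0, coeFn_monomial 0] with t h3 h4 h5
  rw [Nat.cast_zero, h5, Pi.smul_apply, h4, fourier_zero, one_mul, smul_eq_mul] at h3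
  exact eq_inv_of_mul_eq_one_right h3.symm

end IsInner

/-- The backward shift `f ↦ (f - f(0)) / z`. -/
noncomputable def backwardShift (f : L2) : L2 := shift (-1) (f - fourierCoeff f 0 • monomial 0)

theorem backwardShift_mem_K {u : ℂ → ℂ} (hu : IsInner u) {f : L2} (hf : f ∈ K u) :
    backwardShift f ∈ K u := by
  rw [hu.mem_K] at hf ⊢
  refine ⟨fun n hn => ?_, fun h hh => ?_⟩
  · rw [backwardShift, fourierCoeff_shift, fourierCoeff_sub, ← inner_monomial _ (_ • _),
      inner_smul_right, inner_monomial, fourierCoeff_monomial]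
    split_ifs with h0
    · rw [h0, mul_one, sub_self]
    · rw [hf.1 _ (by omega), mul_zero, sub_zero]
  -- $\langle uh,S^*f\rangle=\langle zuh,f-f(0)\rangle$; here $f\perp u(zh)$, and $zuh$ has mean
  -- zero.
  · have h1 : shift 1 (hu.mul h) = hu.mul (shift 1 h) := mulBdd_comm _ _ _
    have h2 : hu.mul h = shift (-1) (shift 1 (hu.mul h)) :=
      sub_eq_zero.1 <| eq_zero_of_fourierCoeff fun n => by
        rw [fourierCoeff_sub, fourierCoeff_shift, fourierCoeff_shift, sub_eq_zero]
        congr 1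
        ring
    rw [h2, backwardShift, inner_shift_shift, inner_sub_right, h1,
      hf.2 _ (shift_mem_H2 zero_le_one hh), ← h1, inner_smul_right, ← inner_conj_symm,
      inner_monomial, fourierCoeff_shift, hu.mul_mem_H2 hh _ (by norm_num), map_zero, mul_zero,
      sub_zero]

theorem memLp_top_backwardShift {f : L2} (hf : MemLp f ∞ arc) :
    MemLp (backwardShift f) ∞ arc :=
  memLp_top_mulBdd _ (memLp_top_sub hf (memLp_top_smul _ (memLp_top_monomial 0)))

theorem mulBdd_backwardShift {f : L2} (hf : MemLp f ∞ arc) (φ : L2) :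
    mulBdd _ (memLp_top_backwardShift hf) φ =
      shift (-1) (mulBdd f hf φ - fourierCoeff f 0 • φ) := by
  apply Lp.ext
  filter_upwards [coeFn_mulBdd _ (memLp_top_backwardShift hf) φ, coeFn_mulBdd _ hf φ,
    coeFn_mulBdd _ (memLp_top_fourier (-1)) (mulBdd f hf φ - fourierCoeff f 0 • φ),
    coeFn_mulBdd _ (memLp_top_fourier (-1)) (f - fourierCoeff f 0 • monomial 0),
    Lp.coeFn_sub (mulBdd f hf φ) (fourierCoeff f 0 • φ), Lp.coeFn_smul (fourierCoeff f 0) φ,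
    Lp.coeFn_sub f (fourierCoeff f 0 • monomial 0), Lp.coeFn_smul (fourierCoeff f 0) (monomial 0),
    coeFn_monomial 0] with t h1 h2 h3 h4 h5 h6 h7 h8 h9
  rw [h1, h3, h5, Pi.sub_apply, h2, h6, backwardShift, h4, h7, Pi.sub_apply, h8, Pi.smul_apply,
    Pi.smul_apply, h9, fourier_zero, smul_eq_mul, smul_eq_mul]
  ring

theorem inner_backwardShift {f : L2} (hf : MemLp f ∞ arc) (φ g : L2) :
    inner ℂ (backwardShift g) (mulBdd _ (memLp_top_backwardShift hf) φ) =
      inner ℂ g (mulBdd f hf φ) - fourierCoeff f 0 * inner ℂ g φ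
        - conj (fourierCoeff g 0) * inner ℂ (monomial 0) (mulBdd f hf φ)
        + conj (fourierCoeff g 0) * fourierCoeff f 0 * inner ℂ (monomial 0) φ := by
  rw [mulBdd_backwardShift hf, backwardShift, inner_shift_shift]
  simp only [inner_sub_left, inner_sub_right, inner_smul_left, inner_smul_right]
  ring

theorem inner_monomial_mulBdd_star {f : L2} (hf : MemLp f ∞ arc) (g : L2) (n : ℤ) :
    inner ℂ (monomial n) (mulBdd f hf (star g)) = inner ℂ (shift n g) f := by
  rw [L2.inner_def, L2.inner_def]
  apply integral_congr_ae
  filter_upwards [coeFn_mulBdd f hf (star g), coeFn_monomial n, Lp.coeFn_star g,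
    coeFn_mulBdd _ (memLp_top_fourier n) g] with t h1 h2 h3 h4
  rw [h1, h2, h3, h4]
  simp only [RCLike.inner_apply', map_mul, Pi.star_apply, RCLike.star_def]
  ring

theorem fourierCoeff_star (f : L2) (n : ℤ) :
    fourierCoeff (star f : L2) n = conj (fourierCoeff f (-n)) := by
  rw [← fourierCoeff_conj]
  exact congrFun (fourierCoeff_congr_ae (Lp.coeFn_star f)) n

theorem shift_zero (f : L2) : shift 0 f = f :=
  sub_eq_zero.1 <| eq_zero_of_fourierCoeff fun n => by
    rw [fourierCoeff_sub, fourierCoeff_shift, sub_zero, sub_self]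

/-! ### Toeplitz operators -/

theorem prod_eq_mulBdd {u : ℂ → ℂ} (φ : L2) (f : Kbdd u) : prod φ f = mulBdd _ f.2 φ := by
  apply Lp.ext
  filter_upwards [coeFn_mulBdd _ f.2 φ, MemLp.coeFn_toLp
    (MemLp.mul (p := 2) (q := ∞) (r := 2) f.2 (Lp.memLp φ))] with t h1 h2
  exact h2.trans ((mul_comm _ _).trans h1.symm)

theorem toeplitz_apply_eq_zero_iff {α β : ℂ → ℂ} (φ : L2) (f : (toeplitz α β φ).domain) :
    toeplitz α β φ f = 0 ↔ ∀ g ∈ K β, inner ℂ g (mulBdd _ f.2 φ) = 0 := by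
  refine (Submodule.orthogonalProjectionOnto_eq_zero_iff (K := K β)
    (v := prod (u := α) φ f)).trans ?_
  exact (congrArg (· ∈ (K β)ᗮ) (prod_eq_mulBdd (u := α) φ f)).to_iff.trans
    (Submodule.mem_orthogonal _ _)

theorem eq_zero_iff_forall_inner {α β : ℂ → ℂ} (hα : IsInner α) {φ : L2} {A : K α →L[ℂ] K β}
    (hA : IsBoundedToeplitz α β φ A) :
    A = 0 ↔ ∀ f ∈ K α, ∀ hf : MemLp f ∞ arc, ∀ g ∈ K β, inner ℂ g (mulBdd f hf φ) = 0 := by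
  constructor
  · rintro rfl f hf hf' g hg
    exact (toeplitz_apply_eq_zero_iff φ ⟨⟨f, hf⟩, hf'⟩).1 (hA ⟨⟨f, hf⟩, hf'⟩).symm g hg
  · intro h
    refine DFunLike.coe_injective
      (A.continuous.ext_on hα.dense_Kbdd (0 : K α →L[ℂ] K β).continuous fun f hf => ?_)
    exact (hA ⟨f, hf⟩).trans ((toeplitz_apply_eq_zero_iff φ ⟨f, hf⟩).2 (h f f.2 hf))

theorem inner_mulBdd_eq_zero_of_symbol {α β : ℂ → ℂ} (hα : IsInner α) (hβ : IsInner β)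
    {a b : L2} (ha : a ∈ mulH2 α) (hb : b ∈ mulH2 β) {f : L2} (hf : f ∈ K α)
    (hf' : MemLp f ∞ arc) {g : L2} (hg : g ∈ K β) :
    inner ℂ g (mulBdd f hf' (star a + b)) = 0 := by
  obtain ⟨h₁, hh₁, rfl⟩ := hα.mem_mulH2.1 ha
  obtain ⟨h₂, hh₂, rfl⟩ := hβ.mem_mulH2.1 hb
  have h1 : inner ℂ (mulBdd f hf' (star (hα.mul h₁))) g = 0 := by
    refine inner_eq_zero_of_mem_H2 (fun n hn => ?_) hg.1
    rw [← inner_monomial, inner_monomial_mulBdd_star, mulBdd_comm]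
    exact (hα.mem_K.1 hf).2 _ (shift_mem_H2 hn hh₁)
  have h2 : inner ℂ (mulBdd f hf' (hβ.mul h₂)) g = 0 := by
    rw [mulBdd_comm]
    exact (hβ.mem_K.1 hg).2 _ (mulBdd_mem_H2 hf' (fun n hn => hf.1 n hn) hh₂)
  rw [← inner_conj_symm, map_add, inner_add_left, h1, h2, add_zero, map_zero]

theorem exists_symbol_of_inner_mulBdd_eq_zero {α β : ℂ → ℂ} (hα : IsInner α)
    (hα' : Nonconstant α) (hβ : IsInner β) (hβ' : Nonconstant β) {φ : L2}
    (h : ∀ f ∈ K α, ∀ hf : MemLp f ∞ arc, ∀ g ∈ K β, inner ℂ g (mulBdd f hf φ) = 0) :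
    ∃ a ∈ mulH2 α, ∃ b ∈ mulH2 β, φ = star a + b := by
  set m := fourierCoeff φ 0 with hm
  have key : ∀ f ∈ K α, MemLp f ∞ arc → ∀ g ∈ K β,
      fourierCoeff f 0 * inner ℂ g φ + conj (fourierCoeff g 0) * inner ℂ (star φ) f =
        conj (fourierCoeff g 0) * fourierCoeff f 0 * m := fun f hf hf' g hg => by
    have h1 := inner_backwardShift hf' φ g
    rw [h f hf hf' g hg, h _ (backwardShift_mem_K hα hf) (memLp_top_backwardShift hf') _
      (backwardShift_mem_K hβ hg), inner_monomial 0 φ] at h1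
    have h2 := inner_monomial_mulBdd_star hf' (star φ) 0
    rw [star_star, shift_zero] at h2
    rw [← h2]
    linear_combination h1
  have hf₀ := hα.fourierCoeff_projMonomial_zero_ne_zero hα'
  have hg₀ := hβ.fourierCoeff_projMonomial_zero_ne_zero hβ'
  have hk₀ := key _ (hα.projMonomial_mem_K 0) (hα.memLp_top_projMonomial 0)
  set f₀ := hα.projMonomial 0
  set g₀ := hβ.projMonomial 0
  -- The value of $c$ comes from solving `key` at $f=f_0$ for $\langle g,\varphi\rangle$.
  set c := m - inner ℂ (star φ) f₀ / fourierCoeff f₀ 0 with hc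
  have h1 : ∀ g ∈ K β, inner ℂ g φ = conj (fourierCoeff g 0) * c := fun g hg => by
    have := hk₀ g hg
    rw [hc]
    field_simp
    linear_combination this
  have h2 : ∀ f ∈ K α, MemLp f ∞ arc → inner ℂ (star φ) f = fourierCoeff f 0 * (m - c) :=
    fun f hf hf' => by
      have h3 := key f hf hf' g₀ (hβ.projMonomial_mem_K 0)
      rw [h1 g₀ (hβ.projMonomial_mem_K 0)] at h3
      refine mul_left_cancel₀ ((map_ne_zero conj).2 hg₀) ?_
      linear_combination h3
  -- Both sides are continuous in $f$, so density removes the boundedness assumption of `h2`.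
  have h3 : ∀ f ∈ K α, inner ℂ (star φ - conj (m - c) • monomial 0) f = 0 := fun f hf => by
    have h4 := (continuous_const.inner continuous_subtype_val :
      Continuous fun x : K α => inner ℂ (star φ - conj (m - c) • monomial 0) (x : L2)).ext_on
      hα.dense_Kbdd (continuous_const (y := (0 : ℂ))) fun x hx => by
        simp only
        rw [inner_sub_left, inner_smul_left, h2 x x.2 hx, inner_monomial, Complex.conj_conj]
        ring
    exact congrFun h4 ⟨f, hf⟩
  refine ⟨_, hα.mem_mulH2_of_orthogonal (riesz_mem (star φ - conj (m - c) • monomial 0))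
    fun f hf => ?_, _, hβ.mem_mulH2_of_orthogonal (riesz_mem (φ - c • monomial 0))
    fun g hg => ?_, ?_⟩
  · rw [inner_riesz hf.1, ← inner_conj_symm, h3 f hf, map_zero]
  · rw [inner_riesz hg.1, inner_sub_right, h1 g hg, inner_smul_right, ← inner_conj_symm,
      inner_monomial]
    ring
  -- Negative frequencies come only from the conjugated term and positive ones only from the other;
  -- at $0$ the two contribute $c$ and $m-c$.
  · refine sub_eq_zero.1 (eq_zero_of_fourierCoeff fun n => ?_)
    have hsmul : ∀ (c : ℂ) (n : ℤ), fourierCoeff (c • monomial 0 : L2) n =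
        if n = 0 then c else 0 := fun c n => by
      rw [← inner_monomial, inner_smul_right, inner_monomial, fourierCoeff_monomial]
      simp
    rw [fourierCoeff_sub, ← inner_monomial _ (_ + _), inner_add_right, inner_monomial,
      inner_monomial, fourierCoeff_star]
    rcases lt_trichotomy n 0 with hn | rfl | hn
    · rw [riesz_mem _ n hn, fourierCoeff_riesz (by omega), fourierCoeff_sub, fourierCoeff_star,
        hsmul, if_neg (by omega)]
      simp
    · rw [neg_zero, fourierCoeff_riesz le_rfl, fourierCoeff_riesz le_rfl, fourierCoeff_sub,
        fourierCoeff_sub, fourierCoeff_star, hsmul, hsmul, if_pos rfl, if_pos rfl, ← hm, neg_zero,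
        ← hm, ← map_sub, Complex.conj_conj]
      ring
    · rw [riesz_mem _ (-n) (by omega), fourierCoeff_riesz hn.le, fourierCoeff_sub, hsmul,
        if_neg hn.ne']
      simp

end ATTO

theorem mainTheorem1 (α β : ℂ → ℂ)
    (hα : ATTO.IsInner α) (hα' : ATTO.Nonconstant α)
    (hβ : ATTO.IsInner β) (hβ' : ATTO.Nonconstant β)
    (φ : ATTO.L2) (A : ATTO.K α →L[ℂ] ATTO.K β)
    (hA : ATTO.IsBoundedToeplitz α β φ A) :
    A = 0 ↔ ∃ f ∈ ATTO.mulH2 α, ∃ g ∈ ATTO.mulH2 β, φ = star f + g := by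
  rw [ATTO.eq_zero_iff_forall_inner hα hA]
  refine ⟨ATTO.exists_symbol_of_inner_mulBdd_eq_zero hα hα' hβ hβ', ?_⟩
  rintro ⟨a, ha, b, hb, rfl⟩ f hf hf' g hg
  exact ATTO.inner_mulBdd_eq_zero_of_symbol hα hβ ha hb hf hf' hg
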